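/- Let $Q$ be a (convex) polytope of dimension $n\ge 0$, i.e. the convex hull of a nonempty finite set of points in a finite-dimensional real normed space (for instance $\mathbb{R}^d$), whose affine span has dimension $n$. Let $\partial Q$ be the boundary of $Q$ relative to its affine span. A facet of $Q$ is a nonempty face of $Q$ of dimension $n-1$. Let $\hat Q$ be the simplicial complex whose simplices are the nonempty sets of vertices of $Q$ contained in a common facet of $Q$. Identify $\hat Q$ with its canonical geometric realization in $\mathbb{R}^{V}$, where $V$ is the set of vertices of $Q$: it is the union, over all simplices $\sigma$ of $\hat Q$, of the convex hulls of the basis vectors $e_v$, $v\in\sigma$. Let $p\colon \hat Q\to\partial Q$ be the canonical map $p\bigl(\sum_v x_v e_v\bigr)=\sum_v x_v v$, that is, the identity on vertices extended linearly to each simplex. Then there exists a piecewise linear embedding $i\colon\partial Q\hookrightarrow\hat Q$ (a topological embedding that is affine on each simplex of some finite triangulation of $\partial Q$) such that $p\circ i=\mathrm{id}_{\partial Q}$, the image $Z=i(\partial Q)$ is (the realization of) a simplicial subcomplex of $\hat Q$, and 1. $Z$ is homeomorphic to the sphere $S^{n-1}=\{x\in\mathbb{R}^n : |x|=1\}$ (so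 $S^{-1}=\varnothing$ when $n=0$); 2. $Z$ is a strong deformation retract of $\hat Q$: there is a retraction $r\colon\hat Q\to Z$ such that, viewed as a map $\hat Q\to\hat Q$, it is homotopic to $\mathrm{id}_{\hat Q}$ by a homotopy fixing $Z$ pointwise. -/

import Mathlib

namespace PolytopeHat

section Polytopes

variable {E : Type*} [NormedAddCommGroup E] [NormedSpace ℝ E]

/-- A (convex) polytope: the convex hull of a nonempty finite set of points. -/
def IsPolytope (Q : Set E) : Prop :=
  ∃ s : Finset E, s.Nonempty ∧ Q = convexHull ℝ (s : Set E)

/-- The dimension of a nonempty convex set: the dimension of its affine span. -/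
noncomputable def dim (Q : Set E) : ℕ := Module.finrank ℝ (vectorSpan ℝ Q)

/-- A facet of `Q`: a nonempty face (the set where some linear functional attains its maximum
over `Q`) whose dimension is `dim Q - 1`. -/
def IsFacet (Q F : Set E) : Prop :=
  F.Nonempty ∧ IsExposed ℝ Q F ∧ dim F + 1 = dim Q

/-- The boundary `∂Q` of a polytope, i.e. its frontier inside its affine span. -/
abbrev boundary (Q : Set E) : Set E := intrinsicFrontier ℝ Q

/-- The vertices of `Q`. -/
abbrev Vertex (Q : Set E) : Type _ := Q.extremePoints ℝ

/-- The simplicial complex `Q̂`: its simplices are the nonempty finite sets of vertices of `Q` that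
lie in a common facet of `Q`. -/
def hat (Q : Set E) : PreAbstractSimplicialComplex (Vertex Q) where
  faces := {s | s.Nonempty ∧ ∃ F, IsFacet Q F ∧ ∀ v ∈ s, (v : E) ∈ F}
  isRelLowerSet_faces := by
    rintro s ⟨hs, F, hF, h⟩
    exact ⟨hs, fun t hts ht => ⟨ht, F, hF, fun v hv => h v (hts hv)⟩⟩

end Polytopes

/-- The canonical geometric realization of a simplicial complex on a finite vertex set `ι`, in
`ℝ^ι`: the union over the simplices `s` of the geometric simplices spanned by the standard basis
vectors `e_i`, `i ∈ s` (points are described by their barycentric coordinates). -/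
def realization {ι : Type*} (K : PreAbstractSimplicialComplex ι) : Set (ι → ℝ) :=
  {x | ∃ s ∈ K.faces, (∀ i, 0 ≤ x i) ∧ (∀ i, i ∉ s → x i = 0) ∧ ∑ i ∈ s, x i = 1}

section CanonicalMap

variable {E : Type*} [NormedAddCommGroup E] [NormedSpace ℝ E]

theorem IsFacet.subset_boundary {Q F : Set E} (hF : IsFacet Q F) : F ⊆ boundary Q := by
  obtain ⟨hne, hexp, hdim⟩ := hF
  obtain ⟨l, hl⟩ := hexp hne
  intro x hx
  have hxQ : x ∈ Q := hexp.subset hx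
  rw [boundary, ← intrinsicClosure_sdiff_intrinsicInterior]
  refine ⟨subset_intrinsicClosure hxQ, fun hint => ?_⟩
  have hsub : Q ⊆ F := by
    intro y hy
    obtain ⟨z, hz, hzx⟩ := mem_intrinsicInterior.1 hint
    rw [mem_interior_iff_mem_nhds] at hz
    have hyA : y ∈ affineSpan ℝ Q := subset_affineSpan ℝ Q hy
    have hxA : x ∈ affineSpan ℝ Q := subset_affineSpan ℝ Q hxQ
    have hmem : ∀ t : ℝ, AffineMap.lineMap x y t ∈ affineSpan ℝ Q :=
      fun t => AffineMap.lineMap_mem t hxA hyA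
    let g : ℝ → affineSpan ℝ Q := fun t => ⟨AffineMap.lineMap x y t, hmem t⟩
    have hg : Continuous g := by
      refine Continuous.subtype_mk ?_ _
      exact AffineMap.lineMap_continuous
    have hg0 : g 0 = z := by
      apply Subtype.ext
      simp [g, hzx]
    have hev : ∀ᶠ t in nhds (0 : ℝ), g t ∈ ((↑) ⁻¹' Q : Set (affineSpan ℝ Q)) := by
      have := hg.tendsto 0
      rw [hg0] at this
      exact this hz
    obtain ⟨ε, hε, hball⟩ := Metric.eventually_nhds_iff.1 hev
    have hneg : AffineMap.lineMap x y (-(ε / 2)) ∈ Q :=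
      hball (y := -(ε / 2)) (by simp [abs_of_pos hε, hε])
    rw [hl] at hx ⊢
    have h1 := hx.2 _ hneg
    rw [AffineMap.lineMap_apply_module'] at h1
    simp only [map_add, map_smul, map_sub, smul_eq_mul] at h1
    refine ⟨hy, fun w hw => (hx.2 w hw).trans ?_⟩
    nlinarith
  have hFQ : F = Q := Set.Subset.antisymm hexp.subset hsub
  rw [hFQ] at hdim
  omega

theorem map_mem_boundary {Q : Set E} (hQ : IsPolytope Q) (x : realization (hat Q)) :
    ∑ᶠ v : Vertex Q, (x : Vertex Q → ℝ) v • (v : E) ∈ boundary Q := by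
  obtain ⟨x, s, ⟨-, F, hF, hsF⟩, h0, hs, h1⟩ := x
  refine hF.subset_boundary ?_
  have hconv : Convex ℝ Q := by
    obtain ⟨t, -, rfl⟩ := hQ
    exact convex_convexHull ℝ _
  have hsum : ∑ᶠ v : Vertex Q, x v • (v : E) = ∑ v ∈ s, x v • (v : E) := by
    refine finsum_eq_sum_of_support_subset _ fun v hv => ?_
    by_contra hvs
    exact hv (by simp [hs v hvs])
  rw [hsum]
  exact (hF.2.1.convex hconv).sum_mem (fun v _ => h0 v) h1 hsF

/-- The canonical map `p : Q̂ → ∂Q`: the identity on vertices, extended linearly to each simplex. -/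
noncomputable def p {Q : Set E} (hQ : IsPolytope Q) (x : realization (hat Q)) : boundary Q :=
  ⟨∑ᶠ v : Vertex Q, (x : Vertex Q → ℝ) v • (v : E), map_mem_boundary hQ x⟩

end CanonicalMap

/-- A map `f : X → Y` between subsets of real vector spaces, with `X` a compact polyhedron, is
piecewise linear if it is affine on each simplex of some finite triangulation of `X`. -/
def IsPiecewiseLinear {E F : Type*} [AddCommGroup E] [Module ℝ E] [AddCommGroup F] [Module ℝ F]
    {X : Set E} {Y : Set F} (f : X → Y) : Prop :=
  ∃ T : Geometry.SimplicialComplex ℝ E, T.faces.Finite ∧ T.space = X ∧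
    ∀ s ∈ T.faces, ∃ g : E →ᵃ[ℝ] F,
      ∀ x : X, (x : E) ∈ convexHull ℝ (s : Set E) → (f x : F) = g x

/-- `Z` is a strong deformation retract of `X`: there is a retraction of `X` onto `Z` that is
homotopic to the identity relative to `Z`. -/
def IsStrongDeformationRetract {X : Type*} [TopologicalSpace X] (Z : Set X) : Prop :=
  ∃ r : C(X, X), (∀ x, r x ∈ Z) ∧ (∀ z ∈ Z, r z = z) ∧ (ContinuousMap.id X).HomotopicRel r Z

end PolytopeHat

/-! The linear map `f` from the standard simplex on the vertices onto `Q` sends each weight vector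
to its barycentre. In every fibre, pick the lexicographically least point; let `G` be the set of
these choices. Then `f` is a bijection from `G` onto `Q`, and `G` is a union of closed faces: if `x`
is least and `y` is supported where `x` is, an improvement `z` of `y` would give the improvement `x
+ ε • (z - y)` of `x`. So `G` triangulates `Q` without new vertices (`exists_coherent_section`).

A functional defining a facet shows that a convex combination of vertices landing in the facet uses
only vertices of that facet. As every boundary point lies in a facet
(`exists_isFacet_of_mem_boundary`), the part of `G` over `∂Q` lies in `Q̂`, and the inverse of `f`
there is the section `i`. For the same reason, segments inside fibres of `p` stay in `Q̂`, so
sliding linearly to `i ∘ p` is the deformation. Finally, `Z` is homeomorphic to `∂Q`, the frontier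
of a convex body. -/

namespace PolytopeHat

/-! ### Lexicographically minimal points in the fibres of a linear map -/

section CoherentSection

/-- A scale-invariant strict "positivity" predicate on `ι → ℝ` (the lexicographic one on the
coordinates in `S`) for which every nonempty compact set has a least element. -/
theorem exists_lex_positivity {ι : Type*} (S : Finset ι) : ∃ P : (ι → ℝ) → Prop,
    (∀ c : ℝ, 0 < c → ∀ z, P (c • z) → P z) ∧ (∀ z, P z → ¬ P (-z)) ∧
    ∀ K : Set (ι → ℝ), IsCompact K → K.Nonempty →
      ∃ x ∈ K, ∀ y ∈ K, (∃ i ∈ S, y i ≠ x i) → P (y - x) := by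
  classical
  induction S using Finset.induction_on with
  | empty =>
    refine ⟨fun _ => False, by simp, by simp, ?_⟩
    rintro K - ⟨x, hx⟩
    exact ⟨x, hx, by simp⟩
  | insert a S _ ih =>
    obtain ⟨P, hP, hP', hK⟩ := ih
    -- The coordinate `a` is compared first; ties are passed to the predicate for `S`.
    refine ⟨fun z => 0 < z a ∨ (z a = 0 ∧ P z), ?_, ?_, ?_⟩
    · rintro c hc z (h | ⟨h, h'⟩)
      · exact Or.inl (pos_of_mul_pos_right h hc.le)
      · exact Or.inr ⟨(mul_eq_zero.1 h).resolve_left hc.ne', hP c hc z h'⟩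
    · rintro z (h | ⟨h, h'⟩) (g | ⟨g, g'⟩)
      · simp only [Pi.neg_apply] at g; linarith
      · simp only [Pi.neg_apply] at g; linarith
      · simp only [Pi.neg_apply] at g; linarith
      · exact hP' z h' g'
    · intro K hKc hKn
      obtain ⟨x₀, hx₀, hmin⟩ := hKc.exists_isMinOn hKn (continuous_apply a).continuousOn
      obtain ⟨x, ⟨hx, hxa⟩, hxP⟩ := hK (K ∩ {y | y a = x₀ a})
        (hKc.inter_right (isClosed_eq (continuous_apply a) continuous_const)) ⟨x₀, hx₀, rfl⟩
      refine ⟨x, hx, fun y hy hne => ?_⟩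
      have hya : x₀ a ≤ y a := hmin hy
      change x a = x₀ a at hxa
      rcases hya.lt_or_eq with h | h
      · left; simp only [Pi.sub_apply]; linarith
      · right
        refine ⟨by simp only [Pi.sub_apply]; linarith, hxP y ⟨hy, h.symm⟩ ?_⟩
        obtain ⟨i, hi, hne⟩ := hne
        rcases Finset.mem_insert.1 hi with rfl | hi
        · exact absurd (h.symm.trans hxa.symm) hne
        · exact ⟨i, hi, hne⟩

/-- Only coordinates with `x i = 0` can become negative at once; the positive ones, finitely many,
tolerate a small `ε`. -/
theorem exists_pos_add_smul_mem_stdSimplex {ι : Type*} [Fintype ι] {x w : ι → ℝ}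
    (hx : x ∈ stdSimplex ℝ ι) (hw : ∑ i, w i = 0) (h : ∀ i, x i = 0 → 0 ≤ w i) :
    ∃ ε : ℝ, 0 < ε ∧ x + ε • w ∈ stdSimplex ℝ ι := by
  have key : ∀ᶠ ε in nhdsWithin (0 : ℝ) (Set.Ioi 0), ∀ i, 0 ≤ x i + ε * w i := by
    refine Filter.eventually_all.2 fun i => ?_
    rcases (hx.1 i).eq_or_lt with h0 | h0
    · filter_upwards [self_mem_nhdsWithin] with ε hε
      rw [← h0, zero_add]
      exact mul_nonneg (le_of_lt hε) (h i h0.symm)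
    · have hc : Continuous fun ε : ℝ => x i + ε * w i := by fun_prop
      have := hc.tendsto 0
      rw [zero_mul, add_zero] at this
      filter_upwards [nhdsWithin_le_nhds (this (lt_mem_nhds h0))] with ε hε using le_of_lt hε
  obtain ⟨ε, hε, hpos⟩ := (key.and self_mem_nhdsWithin).exists
  refine ⟨ε, hpos, fun i => hε i, ?_⟩
  simp [Finset.sum_add_distrib, ← Finset.mul_sum, hw, hx.2]

/-- Each fibre of a linear map on the standard simplex has a distinguished point, such that the set
of distinguished points is a union of closed faces of the simplex. -/
theorem exists_coherent_section {ι E : Type*} [Fintype ι] [NormedAddCommGroup E] [NormedSpace ℝ E]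
    (f : (ι → ℝ) →ₗ[ℝ] E) : ∃ G ⊆ stdSimplex ℝ ι,
      (∀ x ∈ stdSimplex ℝ ι, ∃ y ∈ G, f y = f x) ∧ Set.InjOn f G ∧
      ∀ x ∈ G, ∀ y ∈ stdSimplex ℝ ι, (∀ i, x i = 0 → y i = 0) → y ∈ G := by
  obtain ⟨P, hP, hP', hK⟩ := exists_lex_positivity (Finset.univ : Finset ι)
  refine ⟨{x | x ∈ stdSimplex ℝ ι ∧ ∀ y ∈ stdSimplex ℝ ι, f y = f x → y ≠ x → P (y - x)},
    fun x hx => hx.1, ?_, ?_, ?_⟩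
  · intro x hx
    obtain ⟨y, ⟨hy, hyx⟩, hmin⟩ := hK (stdSimplex ℝ ι ∩ f ⁻¹' {f x})
      ((isCompact_stdSimplex ℝ ι).inter_right
        (isClosed_singleton.preimage f.continuous_of_finiteDimensional)) ⟨x, hx, rfl⟩
    refine ⟨y, ⟨hy, fun z hz hzy hne => hmin z ⟨hz, hzy.trans hyx⟩ ?_⟩, hyx⟩
    simpa using Function.ne_iff.1 hne
  · rintro x ⟨hx, hxm⟩ y ⟨hy, hym⟩ hxy
    by_contra hne
    apply hP' _ (hxm y hy hxy.symm (Ne.symm hne))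
    rw [neg_sub]
    exact hym x hx hxy hne
  · rintro x ⟨hx, hxm⟩ y hy hxy
    refine ⟨hy, fun z hz hzy hne => ?_⟩
    -- Since `f z = f y`, moving `x` along `z - y` stays in its fibre; where `x` vanishes so does
    -- `y`, hence the direction is nonnegative there.
    obtain ⟨ε, hε, hmem⟩ := exists_pos_add_smul_mem_stdSimplex (w := z - y) hx
      (by simp [Finset.sum_sub_distrib, hz.2, hy.2]) fun i hi => by
        simpa [hxy i hi] using hz.1 i
    refine hP ε hε _ ?_
    have := hxm _ hmem (by simp [hzy]) (by simpa [hε.ne', sub_eq_zero] using hne)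
    rwa [add_sub_cancel_left] at this

end CoherentSection

/-! ### From faces in an injectivity set to a geometric simplicial complex -/

section GeometricComplex

variable {ι E : Type*} [Fintype ι] [AddCommGroup E] [Module ℝ E]

/-- `s` spans a closed face of the standard simplex contained in `G`. -/
def SpansIn (G : Set (ι → ℝ)) (s : Finset ι) : Prop :=
  ∀ x ∈ stdSimplex ℝ ι, (∀ i, i ∉ s → x i = 0) → x ∈ G

theorem mem_convexHull_image_iff [DecidableEq E] {a : ι → E} (ha : Function.Injective a)
    (s : Finset ι) (x : E) : x ∈ convexHull ℝ ((s.image a : Finset E) : Set E) ↔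
      ∃ w ∈ stdSimplex ℝ ι, (∀ i, i ∉ s → w i = 0) ∧
        Fintype.linearCombination ℝ a w = x := by
  classical
  rw [Finset.mem_convexHull']
  simp only [Finset.sum_image ha.injOn, Fintype.linearCombination_apply, Finset.forall_mem_image]
  constructor
  · rintro ⟨w, h0, h1, rfl⟩
    refine ⟨fun i => if i ∈ s then w (a i) else 0, ⟨fun i => ?_, ?_⟩, fun i hi => by simp [hi], ?_⟩
    · dsimp only; split_ifs with h
      exacts [h0 h, le_rfl]
    · simpa using h1
    · simp [ite_smul]
  · rintro ⟨w, ⟨h0, h1⟩, hs, rfl⟩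
    rcases isEmpty_or_nonempty ι with hι | hι
    · simp at h1
    have hinv := Function.leftInverse_invFun ha
    refine ⟨fun e => w (Function.invFun a e), fun i _ => h0 _, ?_, ?_⟩
    · simp only [hinv _]
      rw [← h1]
      exact Finset.sum_subset (Finset.subset_univ _) fun i _ hi => hs i hi
    · simp only [hinv _]
      exact Finset.sum_subset (Finset.subset_univ _) fun i _ hi => by simp [hs i hi]

/-- Pushing the barycentre of the face slightly along `w` gives a second point of the face with the
same image, so injectivity on `G` forces `w = 0`. This one fact yields both affine independence and
affine barycentric coordinates. -/
theorem SpansIn.eq_zero {a : ι → E} {G : Set (ι → ℝ)}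
    (hG : Set.InjOn (Fintype.linearCombination ℝ a) G) {s : Finset ι} (hs : SpansIn G s)
    {w : ι → ℝ} (hws : ∀ i, i ∉ s → w i = 0) (hw : ∑ i, w i = 0)
    (hwa : Fintype.linearCombination ℝ a w = 0) : w = 0 := by
  classical
  rcases s.eq_empty_or_nonempty with rfl | hne
  · exact funext fun i => hws i (Finset.notMem_empty i)
  have hcard : (s.card : ℝ) ≠ 0 := by simpa using hne.ne_empty
  let x : ι → ℝ := fun i => if i ∈ s then (s.card : ℝ)⁻¹ else 0
  have hx : x ∈ stdSimplex ℝ ι := by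
    refine ⟨fun i => ?_, by simp [x, hcard]⟩
    dsimp only [x]; split_ifs <;> positivity
  obtain ⟨ε, hε, hmem⟩ := exists_pos_add_smul_mem_stdSimplex hx hw fun i hi => by
    have : i ∉ s := fun h => by simp [x, h, hne.ne_empty] at hi
    rw [hws i this]
  have h1 := hs x hx fun i hi => by simp [x, hi]
  have h2 := hs _ hmem fun i hi => by simp [x, hws i hi, hi]
  have := hG h2 h1 (by rw [map_add, map_smul, hwa, smul_zero, add_zero])
  simpa [hε.ne'] using this

theorem SpansIn.affineIndependent {a : ι → E} {G : Set (ι → ℝ)}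
    (hG : Set.InjOn (Fintype.linearCombination ℝ a) G) {s : Finset ι} (hs : SpansIn G s) :
    AffineIndependent ℝ (fun i : s => a i) := by
  classical
  rw [affineIndependent_iff_of_fintype]
  intro w hw hwa i₀
  rw [Finset.weightedVSub_eq_linear_combination _ hw] at hwa
  let w' : ι → ℝ := fun i => if h : i ∈ s then w ⟨i, h⟩ else 0
  have hws : ∀ i, i ∉ s → w' i = 0 := fun i hi => by simp [w', hi]
  have hsum : Fintype.linearCombination ℝ a w' = 0 := by
    rw [← hwa, Fintype.linearCombination_apply,
      ← Finset.sum_subset (Finset.subset_univ s) fun i _ hi => by simp [hws i hi],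
      ← Finset.sum_coe_sort s]
    exact Finset.sum_congr rfl fun i _ => by simp [w']
  have hsum' : ∑ i, w' i = 0 := by
    rw [← hw, ← Finset.sum_subset (Finset.subset_univ s) fun i _ hi => hws i hi,
      ← Finset.sum_coe_sort s]
    exact Finset.sum_congr rfl fun i _ => by simp [w']
  simpa [w'] using congrFun (hs.eq_zero hG hws hsum' hsum) i₀

/-- Barycentric coordinates with respect to `a i`, `i ∈ s`, extend to an affine map. -/
theorem SpansIn.exists_affineMap {a : ι → E} {G : Set (ι → ℝ)}
    (hG : Set.InjOn (Fintype.linearCombination ℝ a) G) {s : Finset ι} (hs : SpansIn G s) :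
    ∃ g : E →ᵃ[ℝ] (ι → ℝ), ∀ w ∈ stdSimplex ℝ ι, (∀ i, i ∉ s → w i = 0) →
      g (Fintype.linearCombination ℝ a w) = w := by
  by_cases h : ∃ w₀ ∈ stdSimplex ℝ ι, ∀ i, i ∉ s → w₀ i = 0
  · obtain ⟨w₀, hw₀, hws₀⟩ := h
    -- `W` is the direction space of the face; a linear left inverse on `W`, recentred at `w₀`,
    -- recovers the weights.
    let W : Submodule ℝ (ι → ℝ) :=
      { carrier := {w | (∀ i, i ∉ s → w i = 0) ∧ ∑ i, w i = 0}
        add_mem' := fun {x y} hx hy => ⟨fun i hi => by simp [hx.1 i hi, hy.1 i hi],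
          by simp [Finset.sum_add_distrib, hx.2, hy.2]⟩
        zero_mem' := by simp
        smul_mem' := fun c x hx => ⟨fun i hi => by simp [hx.1 i hi],
          by simp [← Finset.mul_sum, hx.2]⟩ }
    have hker : LinearMap.ker ((Fintype.linearCombination ℝ a).comp W.subtype) = ⊥ := by
      refine (LinearMap.ker_eq_bot').2 fun w hw => Subtype.ext ?_
      exact hs.eq_zero hG w.2.1 w.2.2 hw
    obtain ⟨g, hg⟩ := LinearMap.exists_leftInverse_of_injective _ hker
    refine ⟨((W.subtype.comp g).toAffineMap.comp
      (AffineMap.id ℝ E - AffineMap.const ℝ E (Fintype.linearCombination ℝ a w₀))) +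
        AffineMap.const ℝ E w₀, fun w hw hws => ?_⟩
    have hmem : w - w₀ ∈ W := ⟨fun i hi => by simp [hws i hi, hws₀ i hi],
      by simp [Finset.sum_sub_distrib, hw.2, hw₀.2]⟩
    have h1 : g (Fintype.linearCombination ℝ a (w - w₀)) = ⟨w - w₀, hmem⟩ :=
      LinearMap.congr_fun hg ⟨w - w₀, hmem⟩
    have h2 : (g (Fintype.linearCombination ℝ a w - Fintype.linearCombination ℝ a w₀) : ι → ℝ)
        = w - w₀ := by rw [← map_sub, h1]
    change (g (Fintype.linearCombination ℝ a w - Fintype.linearCombination ℝ a w₀) : ι → ℝ)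
      + w₀ = w
    rw [h2, sub_add_cancel]
  · exact ⟨AffineMap.const ℝ E 0, fun w hw hws => absurd ⟨w, hw, hws⟩ h⟩

/-- The geometric realization of a simplicial complex through the points `a i`, when all its faces
lie in a set on which the linear extension of `a` is injective. -/
def geometricComplex [DecidableEq E] {a : ι → E} (ha : Function.Injective a) {G : Set (ι → ℝ)}
    (hG : Set.InjOn (Fintype.linearCombination ℝ a) G) (K : PreAbstractSimplicialComplex ι)
    (hK : ∀ s ∈ K.faces, SpansIn G s) : Geometry.SimplicialComplex ℝ E where
  toPreAbstractSimplicialComplex := K.map a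
  indep := by
    rintro _ ⟨s, hs, rfl⟩
    have := ((hK s hs).affineIndependent hG).range
    have hr : Set.range (fun i : s => a i) = ((s.image a : Finset E) : Set E) := by
      ext; simp
    rw [hr] at this
    exact this
  inter_subset_convexHull := by
    classical
    rintro _ _ ⟨s, hs, rfl⟩ ⟨t, ht, rfl⟩ x ⟨hx, hx'⟩
    obtain ⟨w, hw, hws, rfl⟩ := (mem_convexHull_image_iff ha s x).1 hx
    obtain ⟨w', hw', hwt, heq⟩ := (mem_convexHull_image_iff ha t _).1 hx'
    -- Both weight vectors lie in `G` over the same point, so they agree and are supported on `s ∩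
    -- t`.
    obtain rfl := hG (hK t ht w' hw' hwt) (hK s hs w hw hws) heq
    dsimp only
    rw [← Finset.coe_inter, ← Finset.image_inter _ _ ha, mem_convexHull_image_iff ha]
    refine ⟨w', hw, fun i hi => ?_, rfl⟩
    by_cases h : i ∈ s
    · exact hwt i fun h' => hi (Finset.mem_inter.2 ⟨h, h'⟩)
    · exact hws i h

end GeometricComplex

/-! ### The boundary of a polytope: sphere, supporting functionals, facets -/

section Boundary

variable {E : Type*} [NormedAddCommGroup E] [NormedSpace ℝ E]

theorem IsPolytope.convex {Q : Set E} (hQ : IsPolytope Q) : Convex ℝ Q := by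
  obtain ⟨t, -, rfl⟩ := hQ
  exact convex_convexHull ℝ _

theorem IsPolytope.isCompact {Q : Set E} (hQ : IsPolytope Q) : IsCompact Q := by
  obtain ⟨t, -, rfl⟩ := hQ
  exact t.finite_toSet.isCompact_convexHull (𝕜 := ℝ)

theorem IsPolytope.nonempty {Q : Set E} (hQ : IsPolytope Q) : Q.Nonempty := by
  obtain ⟨t, ht, rfl⟩ := hQ
  exact ht.to_set.convexHull

theorem IsPolytope.finite_extremePoints {Q : Set E} (hQ : IsPolytope Q) :
    (Q.extremePoints ℝ).Finite := by
  obtain ⟨t, -, rfl⟩ := hQ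
  exact t.finite_toSet.subset extremePoints_convexHull_subset

theorem IsPolytope.convexHull_extremePoints {Q : Set E} (hQ : IsPolytope Q) :
    convexHull ℝ (Q.extremePoints ℝ) = Q := by
  rw [← (hQ.finite_extremePoints.isClosed_convexHull (𝕜 := ℝ)).closure_eq]
  exact closure_convexHull_extremePoints hQ.isCompact hQ.convex

theorem IsPolytope.boundary_subset {Q : Set E} (hQ : IsPolytope Q) : boundary Q ⊆ Q :=
  intrinsicFrontier_subset hQ.isCompact.isClosed

/-- Affine coordinates on the affine span of a polytope, in which it is a convex body. -/
theorem exists_affineSpan_homeomorph [FiniteDimensional ℝ E] {n : ℕ} {Q : Set E}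
    (hQ : IsPolytope Q) (hn : dim Q = n) :
    ∃ (φ : affineSpan ℝ Q ≃ₜ EuclideanSpace ℝ (Fin n)) (L : E →ₗ[ℝ] EuclideanSpace ℝ (Fin n))
      (c : EuclideanSpace ℝ (Fin n)), (∀ x : affineSpan ℝ Q, φ x = L x + c) ∧
      Convex ℝ (φ '' ((↑) ⁻¹' Q)) ∧ IsCompact (φ '' ((↑) ⁻¹' Q)) ∧
      (interior (φ '' ((↑) ⁻¹' Q))).Nonempty := by
  obtain ⟨q, hq⟩ := hQ.nonempty
  have hqA : q ∈ affineSpan ℝ Q := subset_affineSpan ℝ Q hq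
  have : Nonempty (affineSpan ℝ Q) := ⟨⟨q, hqA⟩⟩
  have hfr : Module.finrank ℝ (affineSpan ℝ Q).direction
      = Module.finrank ℝ (EuclideanSpace ℝ (Fin n)) := by
    rw [direction_affineSpan, finrank_euclideanSpace_fin]; exact hn
  let e : (affineSpan ℝ Q).direction ≃L[ℝ] EuclideanSpace ℝ (Fin n) :=
    ContinuousLinearEquiv.ofFinrankEq hfr
  let κ : (affineSpan ℝ Q).direction ≃ᵃⁱ[ℝ] affineSpan ℝ Q :=
    AffineIsometryEquiv.vaddConst ℝ (⟨q, hqA⟩ : affineSpan ℝ Q)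
  let φ : affineSpan ℝ Q ≃ₜ EuclideanSpace ℝ (Fin n) :=
    κ.symm.toHomeomorph.trans e.toHomeomorph
  obtain ⟨L, hL⟩ := LinearMap.exists_extend
    (e.toLinearEquiv : (affineSpan ℝ Q).direction →ₗ[ℝ] EuclideanSpace ℝ (Fin n))
  have hφ : ∀ x : affineSpan ℝ Q, φ x = L x + -L q := by
    intro x
    have h1 : φ x = e (x -ᵥ (⟨q, hqA⟩ : affineSpan ℝ Q)) := rfl
    have h2 := LinearMap.congr_fun hL (x -ᵥ (⟨q, hqA⟩ : affineSpan ℝ Q))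
    rw [h1, ← sub_eq_add_neg, ← map_sub]
    exact h2.symm
  have hpre : (φ '' ((↑) ⁻¹' Q)) = φ.symm ⁻¹' ((↑) ⁻¹' Q) := φ.image_eq_preimage_symm _
  refine ⟨φ, L, -L q, hφ, ?_, ?_, ?_⟩
  · have : (φ '' ((↑) ⁻¹' Q)) = (fun x => L x + -L q) '' Q := by
      ext y
      constructor
      · rintro ⟨x, hx, rfl⟩
        exact ⟨x, hx, (hφ x).symm⟩
      · rintro ⟨x, hx, rfl⟩
        exact ⟨⟨x, subset_affineSpan ℝ Q hx⟩, hx, hφ _⟩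
    rw [this]
    have h := (hQ.convex.linear_image L).translate (-L q)
    rw [Set.image_image] at h
    simpa only [add_comm] using h
  · refine IsCompact.image ?_ φ.continuous
    exact Topology.IsInducing.subtypeVal.isCompact_preimage' hQ.isCompact
      (by simpa using subset_affineSpan ℝ Q)
  · rw [← φ.image_interior]
    obtain ⟨x, hx⟩ := hQ.nonempty.intrinsicInterior hQ.convex
    obtain ⟨y, hy, -⟩ := mem_intrinsicInterior.1 hx
    exact ⟨φ y, y, hy, rfl⟩

/-- In affine coordinates `Q` is a convex body, whose frontier is carried to the unit sphere. No
separate case is needed for `n = 0`. -/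
theorem nonempty_boundary_homeomorph_sphere [FiniteDimensional ℝ E] {n : ℕ} {Q : Set E}
    (hQ : IsPolytope Q) (hn : dim Q = n) :
    Nonempty (boundary Q ≃ₜ Metric.sphere (0 : EuclideanSpace ℝ (Fin n)) 1) := by
  obtain ⟨φ, -, -, -, hconv, hcomp, hint⟩ := exists_affineSpan_homeomorph hQ hn
  obtain ⟨h, -, -, hh⟩ :=
    exists_homeomorph_image_interior_closure_frontier_eq_unitBall hconv hint hcomp.isBounded
  rw [← φ.image_frontier] at hh
  rw [← hh]
  exact ⟨(Topology.IsEmbedding.subtypeVal.homeomorphImage _).symm.trans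
    ((φ.image _).trans (h.image _))⟩

theorem exists_supporting_functional [FiniteDimensional ℝ E] {Q : Set E} (hQ : IsPolytope Q)
    {x : E} (hx : x ∈ boundary Q) :
    ∃ l : StrongDual ℝ E, (∀ y ∈ Q, l y ≤ l x) ∧ ∃ z ∈ Q, l z < l x := by
  obtain ⟨φ, L, c, hφ, hconv, -, hint⟩ := exists_affineSpan_homeomorph hQ rfl
  obtain ⟨x, hxf, rfl⟩ := mem_intrinsicFrontier.1 hx
  have hx' : φ x ∈ frontier (φ '' ((↑) ⁻¹' Q)) := by
    rw [← φ.image_frontier]; exact ⟨x, hxf, rfl⟩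
  -- The inequality is strict on the interior, which supplies `z`, and passes weakly to the closure,
  -- which contains the whole body.
  obtain ⟨f, hf⟩ := geometric_hahn_banach_open_point hconv.interior isOpen_interior hx'.2
  have hf' : ∀ y ∈ φ '' ((↑) ⁻¹' Q), f y ≤ f (φ x) := by
    intro y hy
    have hy' : y ∈ closure (interior (φ '' ((↑) ⁻¹' Q))) := by
      rw [hconv.closure_interior_eq_closure_of_nonempty_interior hint]
      exact subset_closure hy
    exact closure_minimal (fun a ha => (hf a ha).le)
      (isClosed_le f.continuous continuous_const) hy'
  refine ⟨f.comp L.toContinuousLinearMap, fun y hy => ?_, ?_⟩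
  · have := hf' _ ⟨⟨y, subset_affineSpan ℝ Q hy⟩, hy, rfl⟩
    simpa [hφ] using this
  · obtain ⟨w, hw⟩ := hint
    obtain ⟨z, hz, rfl⟩ := interior_subset hw
    refine ⟨z, hz, ?_⟩
    simpa [hφ] using hf _ hw

/-- A face that is neither the whole polytope nor a facet can be enlarged by tilting the functional
that defines it. -/
theorem exists_larger_face [FiniteDimensional ℝ E] {Q : Set E} (hQ : IsPolytope Q) {x : E}
    (hx : x ∈ Q) {l : StrongDual ℝ E} (hl : ∀ y ∈ Q, l y ≤ l x) (hlz : ∃ z ∈ Q, l z < l x)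
    (hdim : dim {y ∈ Q | l y = l x} + 1 < dim Q) :
    ∃ l' : StrongDual ℝ E, (∀ y ∈ Q, l' y ≤ l' x) ∧ (∃ z ∈ Q, l' z < l' x) ∧
      dim {y ∈ Q | l y = l x} < dim {y ∈ Q | l' y = l' x} := by
  obtain ⟨z, hz, hzx⟩ := hlz
  set F := {y ∈ Q | l y = l x} with hF
  have hxF : x ∈ F := ⟨hx, rfl⟩
  have hle : Module.finrank ℝ (vectorSpan ℝ F ⊔ Submodule.span ℝ {z - x} : Submodule ℝ E)
      < Module.finrank ℝ (vectorSpan ℝ Q) := by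
    refine lt_of_le_of_lt (Submodule.finrank_add_le_finrank_add_finrank _ _) ?_
    refine lt_of_le_of_lt (Nat.add_le_add_left (finrank_span_le_card _) _) ?_
    simpa only [Finset.card_singleton, Set.toFinset_singleton] using! hdim
  obtain ⟨u, huQ, hu⟩ : ∃ u ∈ vectorSpan ℝ Q,
      u ∉ (vectorSpan ℝ F ⊔ Submodule.span ℝ {z - x} : Submodule ℝ E) := by
    by_contra! h
    exact absurd (Submodule.finrank_mono h) (not_le.2 hle)
  -- `m` is constant on `F` and also at `z`, but not on `Q`; constancy at `z` keeps the tilted face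
  -- proper.
  obtain ⟨m, hmu, hm⟩ := Submodule.exists_le_ker_of_notMem hu
  have hmF : ∀ y ∈ F, m y = m x := fun y hy => by
    have := hm (Submodule.mem_sup_left (vsub_mem_vectorSpan ℝ hy hxF))
    simpa [sub_eq_zero] using this
  have hmz : m z = m x := by
    have := hm (Submodule.mem_sup_right (Submodule.mem_span_singleton_self (z - x)))
    simpa [sub_eq_zero] using this
  obtain ⟨q, hq, hmq⟩ : ∃ q ∈ Q, m q ≠ m x := by
    by_contra! h
    have : vectorSpan ℝ Q ≤ LinearMap.ker m := by
      rw [vectorSpan_eq_span_vsub_set_right ℝ hx, Submodule.span_le]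
      rintro _ ⟨y, hy, rfl⟩
      simpa [sub_eq_zero] using h y hy
    exact hmu (this huQ)
  clear hm hmu hu
  wlog hpos : m x < m q generalizing m
  · exact this (-m) (by simpa using hmF) (by simpa using hmz) (by simpa using hmq)
      (by simpa using lt_of_le_of_ne (not_lt.1 hpos) hmq)
  obtain ⟨V, -, hV⟩ := id hQ
  have hVQ : ∀ v ∈ V, v ∈ Q := fun v hv => hV ▸ subset_convexHull ℝ _ hv
  have hhull : ∀ f : E →ₗ[ℝ] ℝ, (∀ v ∈ V, f v ≤ f x) → ∀ y ∈ Q, f y ≤ f x := by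
    intro f hf y hy
    rw [hV] at hy
    exact convexHull_min hf (convex_halfSpace_le f.isLinear _) hy
  let V' := V.filter fun v => m x < m v
  have hV' : V'.Nonempty := by
    by_contra h
    refine absurd (hhull m (fun v hv => ?_) q hq) (not_le.2 hpos)
    by_contra hlt
    exact h ⟨v, Finset.mem_filter.2 ⟨hv, not_le.1 hlt⟩⟩
  -- Ratio test: the minimal ratio `t` is the largest tilt for which `l + t • m` is still maximal at
  -- `x`, and `v₀` then joins the face.
  obtain ⟨v₀, hv₀, hmin⟩ := V'.exists_min_image (fun v => (l x - l v) / (m v - m x)) hV'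
  obtain ⟨hv₀V, hv₀m⟩ := Finset.mem_filter.1 hv₀
  set t := (l x - l v₀) / (m v₀ - m x) with ht
  have ht0 : 0 ≤ t := div_nonneg (sub_nonneg.2 (hl _ (hVQ _ hv₀V))) (sub_nonneg.2 hv₀m.le)
  let l' : StrongDual ℝ E := l + t • m.toContinuousLinearMap
  have hl' : ∀ y, l' y = l y + t * m y := fun y => rfl
  have hv₀eq : l' v₀ = l' x := by
    have : t * (m v₀ - m x) = l x - l v₀ := div_mul_cancel₀ _ (sub_pos.2 hv₀m).ne'
    rw [hl', hl']; linarith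
  refine ⟨l', hhull (l' : E →ₗ[ℝ] ℝ) fun v hv => ?_, ⟨z, hz, ?_⟩, ?_⟩
  · change l' v ≤ l' x
    rw [hl', hl']
    have hlv := hl v (hVQ v hv)
    rcases le_or_gt (m v) (m x) with h | h
    · nlinarith [mul_le_mul_of_nonneg_left h ht0]
    · have := hmin v (Finset.mem_filter.2 ⟨hv, h⟩)
      rw [le_div_iff₀ (sub_pos.2 h)] at this
      linarith
  · rw [hl', hl', hmz]; linarith
  · have hsub : F ⊆ {y ∈ Q | l' y = l' x} := fun y hy =>
      ⟨hy.1, by rw [hl', hl', hmF y hy, hy.2]⟩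
    refine Submodule.finrank_lt_finrank_of_lt
      (lt_of_le_of_ne (vectorSpan_mono ℝ hsub) fun heq => ?_)
    have h1 : v₀ - x ∈ vectorSpan ℝ F := by
      rw [heq]
      exact vsub_mem_vectorSpan ℝ (show v₀ ∈ {y ∈ Q | l' y = l' x} from ⟨hVQ _ hv₀V, hv₀eq⟩)
        ⟨hx, rfl⟩
    have h2 : vectorSpan ℝ F ≤ LinearMap.ker m := by
      rw [vectorSpan_eq_span_vsub_set_right ℝ hxF, Submodule.span_le]
      rintro _ ⟨y, hy, rfl⟩
      simpa [sub_eq_zero] using hmF y hy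
    have h3 := h2 h1
    rw [LinearMap.mem_ker, map_sub] at h3
    linarith

/-- Start from a supporting functional and tilt it until the face through `x` has codimension one.
-/
theorem exists_isFacet_of_mem_boundary [FiniteDimensional ℝ E] {Q : Set E} (hQ : IsPolytope Q)
    {x : E} (hx : x ∈ boundary Q) : ∃ F, IsFacet Q F ∧ x ∈ F := by
  have hxQ := hQ.boundary_subset hx
  obtain ⟨l, hl, hlz⟩ := exists_supporting_functional hQ hx
  induction hk : dim Q - dim {y ∈ Q | l y = l x} using Nat.strong_induction_on generalizing l with
  | _ k ih =>
    -- Properness of the face makes the truncated subtraction decrease, and turns `h` into equality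
    -- in the last case.
    have hlt : dim {y ∈ Q | l y = l x} < dim Q := by
      refine Submodule.finrank_lt_finrank_of_lt
        (lt_of_le_of_ne (vectorSpan_mono ℝ fun y hy => hy.1) fun heq => ?_)
      obtain ⟨z, hz, hzx⟩ := hlz
      have h1 : z - x ∈ vectorSpan ℝ {y ∈ Q | l y = l x} := by
        rw [heq]; exact vsub_mem_vectorSpan ℝ hz hxQ
      have h2 : vectorSpan ℝ {y ∈ Q | l y = l x} ≤ LinearMap.ker (l : E →ₗ[ℝ] ℝ) := by
        rw [vectorSpan_eq_span_vsub_set_right ℝ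
          (show x ∈ {y ∈ Q | l y = l x} from ⟨hxQ, rfl⟩), Submodule.span_le]
        rintro _ ⟨y, hy, rfl⟩
        simpa [sub_eq_zero] using hy.2
      have h3 : l (z - x) = 0 := h2 h1
      rw [map_sub] at h3
      linarith
    rcases Nat.lt_or_ge (dim {y ∈ Q | l y = l x} + 1) (dim Q) with h | h
    · obtain ⟨l', hl', hlz', hd⟩ := exists_larger_face hQ hxQ hl hlz h
      exact ih _ (by omega) l' hl' hlz' rfl
    · refine ⟨{y ∈ Q | l y = l x}, ⟨⟨x, hxQ, rfl⟩, fun _ => ⟨l, ?_⟩, by omega⟩, hxQ, rfl⟩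
      ext y
      refine ⟨fun hy => ⟨hy.1, fun w hw => hy.2 ▸ hl w hw⟩, fun hy => ⟨hy.1, ?_⟩⟩
      exact le_antisymm (hl y hy.1) (hy.2 x hxQ)

end Boundary

/-! ### The realization of `hat Q`, the map `p`, and its section -/

theorem mem_realization_iff {ι : Type*} [Fintype ι] {K : PreAbstractSimplicialComplex ι}
    {x : ι → ℝ} : x ∈ realization K ↔
      ∃ s ∈ K.faces, x ∈ stdSimplex ℝ ι ∧ ∀ i, i ∉ s → x i = 0 := by
  refine exists_congr fun s => and_congr_right fun _ => ?_
  constructor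
  · rintro ⟨h0, hs, h1⟩
    exact ⟨⟨h0, by rwa [← Finset.sum_subset (Finset.subset_univ s) fun i _ hi => hs i hi]⟩, hs⟩
  · rintro ⟨⟨h0, h1⟩, hs⟩
    exact ⟨h0, hs, by rwa [Finset.sum_subset (Finset.subset_univ s) fun i _ hi => hs i hi]⟩

theorem IsPiecewiseLinear.continuous {E F : Type*} [NormedAddCommGroup E] [NormedSpace ℝ E]
    [FiniteDimensional ℝ E] [NormedAddCommGroup F] [NormedSpace ℝ F] {X : Set E} {Y : Set F}
    {f : X → Y} (hf : IsPiecewiseLinear f) : Continuous f := by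
  obtain ⟨T, hfin, hspace, hT⟩ := hf
  have := hfin.to_subtype
  have hloc : LocallyFinite fun s : T.faces =>
      ((↑) ⁻¹' convexHull ℝ ((s : Finset E) : Set E) : Set X) := locallyFinite_of_finite _
  refine hloc.continuous ?_ (fun s => ?_) fun s => ?_
  · refine Set.eq_univ_of_forall fun x => ?_
    obtain ⟨s, hs, hx⟩ := Geometry.SimplicialComplex.mem_space_iff.1 (hspace.symm.subset x.2)
    exact Set.mem_iUnion.2 ⟨⟨s, hs⟩, hx⟩
  · exact (Set.Finite.isClosed_convexHull (𝕜 := ℝ) (s : Finset E).finite_toSet).preimage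
      continuous_subtype_val
  · obtain ⟨g, hg⟩ := hT s s.2
    have hgc : Continuous fun x : X => g x :=
      g.continuous_of_finiteDimensional.comp continuous_subtype_val
    exact Topology.IsInducing.subtypeVal.continuousOn_iff.2
      (hgc.continuousOn.congr fun x hx => hg x hx)

section Polytope

variable {E : Type*} [NormedAddCommGroup E] [NormedSpace ℝ E] {Q : Set E}

theorem coe_p [Fintype (Vertex Q)] (hQ : IsPolytope Q) (x : realization (hat Q)) :
    (p hQ x : E) = Fintype.linearCombination ℝ (Subtype.val : Vertex Q → E) x := by
  rw [Fintype.linearCombination_apply]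
  exact finsum_eq_sum_of_fintype _

theorem continuous_p [Fintype (Vertex Q)] (hQ : IsPolytope Q) : Continuous (p hQ) := by
  refine continuous_induced_rng.2 ?_
  have : (Subtype.val ∘ p hQ) = fun x : realization (hat Q) =>
      Fintype.linearCombination ℝ (Subtype.val : Vertex Q → E) x := funext (coe_p hQ)
  rw [this]
  exact (LinearMap.continuous_of_finiteDimensional _).comp continuous_subtype_val

theorem exists_mem_stdSimplex_of_mem [Fintype (Vertex Q)] (hQ : IsPolytope Q) {x : E}
    (hx : x ∈ Q) : ∃ w ∈ stdSimplex ℝ (Vertex Q),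
      Fintype.linearCombination ℝ (Subtype.val : Vertex Q → E) w = x := by
  classical
  have hcoe : ((Finset.univ.image (Subtype.val : Vertex Q → E) : Finset E) : Set E)
      = Q.extremePoints ℝ := by ext; simp
  rw [← hQ.convexHull_extremePoints, ← hcoe,
    mem_convexHull_image_iff Subtype.val_injective] at hx
  obtain ⟨w, hw, -, rfl⟩ := hx
  exact ⟨w, hw, rfl⟩

/-- A convex combination of vertices lying in a facet only involves vertices of that facet. -/
theorem IsFacet.mem_of_linearCombination_mem [Fintype (Vertex Q)] {F : Set E} (hF : IsFacet Q F)
    {w : Vertex Q → ℝ} (hw : w ∈ stdSimplex ℝ (Vertex Q))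
    (h : Fintype.linearCombination ℝ (Subtype.val : Vertex Q → E) w ∈ F) {v : Vertex Q}
    (hv : w v ≠ 0) : (v : E) ∈ F := by
  obtain ⟨l, rfl⟩ := hF.2.1 hF.1
  set x := Fintype.linearCombination ℝ (Subtype.val : Vertex Q → E) w with hx
  have hle : ∀ u : Vertex Q, 0 ≤ w u * (l x - l u) := fun u =>
    mul_nonneg (hw.1 u) (sub_nonneg.2 (h.2 u u.2.1))
  -- The functional at the barycentre is the weighted mean of its values, so the nonnegative
  -- deficits add up to zero.
  have hsum : ∑ u, w u * (l x - l u) = 0 := by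
    have : l x = ∑ u : Vertex Q, w u * l u := by
      rw [hx, Fintype.linearCombination_apply]
      simp
    simp only [mul_sub, Finset.sum_sub_distrib, ← Finset.sum_mul, hw.2]
    rw [one_mul, ← this, sub_self]
  have h0 := (Finset.sum_eq_zero_iff_of_nonneg fun u _ => hle u).1 hsum v (Finset.mem_univ v)
  have heq := sub_eq_zero.1 ((mul_eq_zero.1 h0).resolve_left hv)
  exact ⟨v.2.1, fun y hy => heq ▸ h.2 y hy⟩

theorem IsFacet.mem_realization [Fintype (Vertex Q)] {F : Set E} (hF : IsFacet Q F)
    {w : Vertex Q → ℝ} (hw : w ∈ stdSimplex ℝ (Vertex Q))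
    (h : ∀ v : Vertex Q, (v : E) ∉ F → w v = 0) : w ∈ realization (hat Q) := by
  classical
  refine mem_realization_iff.2 ⟨Finset.univ.filter fun v => w v ≠ 0, ⟨?_, F, hF, ?_⟩, hw, ?_⟩
  · by_contra hne
    rw [Finset.not_nonempty_iff_eq_empty, Finset.filter_eq_empty_iff] at hne
    have : ∑ v, w v = 0 := Finset.sum_eq_zero fun v hv => not_not.1 (hne hv)
    linarith [hw.2]
  · intro v hv
    by_contra hvF
    exact (Finset.mem_filter.1 hv).2 (h v hvF)
  · intro v hv
    simpa using hv

/-- The fibres of `p` are convex, and more precisely segments in a fibre stay inside `Q̂`. -/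
theorem lineMap_mem_realization [Fintype (Vertex Q)] (hQ : IsPolytope Q)
    {x y : realization (hat Q)} (hxy : p hQ x = p hQ y) {t : ℝ} (ht : t ∈ Set.Icc (0 : ℝ) 1) :
    AffineMap.lineMap (x : Vertex Q → ℝ) (y : Vertex Q → ℝ) t ∈ realization (hat Q) := by
  obtain ⟨s, ⟨-, F, hF, hsF⟩, hx, hxs⟩ := mem_realization_iff.1 x.2
  obtain ⟨-, -, hy, -⟩ := mem_realization_iff.1 y.2
  have hxF : ∀ v : Vertex Q, (v : E) ∉ F → (x : Vertex Q → ℝ) v = 0 := fun v hv =>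
    hxs v fun hvs => hv (hsF v hvs)
  have hconv : Convex ℝ Q := hQ.convex
  have hpx : (p hQ x : E) ∈ F := by
    rw [coe_p, Fintype.linearCombination_apply,
      ← Finset.sum_subset (Finset.subset_univ s) fun i _ hi => by simp [hxs i hi]]
    refine (hF.2.1.convex hconv).sum_mem (fun v _ => hx.1 v) ?_ hsF
    rw [Finset.sum_subset (Finset.subset_univ s) fun i _ hi => hxs i hi]
    exact hx.2
  rw [hxy, coe_p] at hpx
  refine hF.mem_realization ?_ fun v hv => ?_
  · exact (convex_stdSimplex ℝ (Vertex Q)).lineMap_mem hx hy ht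
  · have hyv : (y : Vertex Q → ℝ) v = 0 := by
      by_contra hne
      exact hv (hF.mem_of_linearCombination_mem hy hpx hne)
    simp [AffineMap.lineMap_apply, hxF v hv, hyv]

/-- The retraction `i ∘ p` preserves the fibres of `p`, so the straight-line homotopy to it stays in
`Q̂`. -/
theorem isStrongDeformationRetract_range [Fintype (Vertex Q)] (hQ : IsPolytope Q)
    {i : boundary Q → realization (hat Q)} (hi : Continuous i) (hpi : p hQ ∘ i = id) :
    IsStrongDeformationRetract (Set.range i) := by
  have hp : ∀ y, p hQ (i y) = y := fun y => congrFun hpi y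
  let r : C(realization (hat Q), realization (hat Q)) := ⟨i ∘ p hQ, hi.comp (continuous_p hQ)⟩
  have hr : ∀ z ∈ Set.range i, r z = z := by
    rintro _ ⟨y, rfl⟩
    exact congrArg i (hp y)
  refine ⟨r, fun x => ⟨_, rfl⟩, hr, ⟨?_⟩⟩
  refine
    { toFun := fun tx => ⟨AffineMap.lineMap (tx.2 : Vertex Q → ℝ) (r tx.2 : Vertex Q → ℝ)
        (tx.1 : ℝ), lineMap_mem_realization hQ (hp _).symm tx.1.2⟩
      continuous_toFun := ?_
      map_zero_left := fun x => by simp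
      map_one_left := fun x => by simp
      prop' := fun t x hx => ?_ }
  · refine Continuous.subtype_mk ?_ _
    simp only [AffineMap.lineMap_apply_module]
    have := r.continuous
    fun_prop
  · apply Subtype.ext
    have := hr x hx
    simp [this]

variable [FiniteDimensional ℝ E]

/-- The boundary of a polytope has a triangulation without new vertices; it lifts to `Q̂`. -/
theorem exists_isPiecewiseLinear_section (hQ : IsPolytope Q) :
    ∃ i : boundary Q → realization (hat Q), IsPiecewiseLinear i ∧ p hQ ∘ i = id ∧
      ∃ L : PreAbstractSimplicialComplex (Vertex Q), L ≤ hat Q ∧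
        Subtype.val '' Set.range i = realization L := by
  classical
  have := hQ.finite_extremePoints.fintype
  set f := Fintype.linearCombination ℝ (Subtype.val : Vertex Q → E) with hf
  obtain ⟨G, hGs, hGex, hGinj, hGface⟩ := exists_coherent_section f
  have hex : ∀ y : boundary Q, ∃ w : realization (hat Q), (w : Vertex Q → ℝ) ∈ G ∧ f w = y := by
    intro y
    obtain ⟨w₀, hw₀, hfw₀⟩ := exists_mem_stdSimplex_of_mem hQ (hQ.boundary_subset y.2)
    obtain ⟨w, hw, hfw⟩ := hGex w₀ hw₀
    obtain ⟨F, hF, hyF⟩ := exists_isFacet_of_mem_boundary hQ y.2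
    have hwy : f w = y := hfw.trans hfw₀
    refine ⟨⟨w, hF.mem_realization (hGs hw) fun v hv => ?_⟩, hw, hwy⟩
    by_contra hne
    exact hv (hF.mem_of_linearCombination_mem (hGs hw) (by rwa [← hf, hwy]) hne)
  choose i hiG hfi using hex
  have hpi : ∀ y, p hQ (i y) = y := fun y => Subtype.ext ((coe_p hQ _).trans (hfi y))
  have hip : ∀ x : realization (hat Q), (x : Vertex Q → ℝ) ∈ G → i (p hQ x) = x := fun x hx =>
    Subtype.ext (hGinj (hiG _) hx ((hfi _).trans (coe_p hQ x)))
  -- Simplices of `hat Q` whose whole closed face lies in `G`; each point of `G` over `∂Q` lies in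
  -- the one spanned by its support.
  let L : PreAbstractSimplicialComplex (Vertex Q) :=
    { faces := {s | s ∈ (hat Q).faces ∧ SpansIn G s}
      isRelLowerSet_faces := by
        rintro s ⟨hs, hsG⟩
        refine ⟨hs.1, fun t hts ht => ⟨((hat Q).isRelLowerSet_faces hs).2 hts ht, ?_⟩⟩
        exact fun x hx hxt => hsG x hx fun v hv => hxt v fun h => hv (hts h) }
  have hL : ∀ x : realization (hat Q), (x : Vertex Q → ℝ) ∈ G →
      ∃ s ∈ L.faces, (x : Vertex Q → ℝ) ∈ stdSimplex ℝ (Vertex Q) ∧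
        ∀ v, v ∉ s → (x : Vertex Q → ℝ) v = 0 := by
    intro x hx
    obtain ⟨s, hs, hxs, hsupp⟩ := mem_realization_iff.1 x.2
    have hsub : (s.filter fun v => (x : Vertex Q → ℝ) v ≠ 0) ⊆ s := Finset.filter_subset _ _
    have hzero : ∀ v, v ∉ (s.filter fun v => (x : Vertex Q → ℝ) v ≠ 0) →
        (x : Vertex Q → ℝ) v = 0 := by
      intro v hv
      by_contra hne
      exact hv (Finset.mem_filter.2 ⟨by_contra fun h => hne (hsupp v h), hne⟩)
    refine ⟨s.filter fun v => (x : Vertex Q → ℝ) v ≠ 0,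
      ⟨((hat Q).isRelLowerSet_faces hs).2 hsub ?_, ?_⟩, hxs, hzero⟩
    · by_contra hne
      rw [Finset.not_nonempty_iff_eq_empty] at hne
      have : ∑ v, (x : Vertex Q → ℝ) v = 0 :=
        Finset.sum_eq_zero fun v _ => hzero v (by simp [hne])
      linarith [hxs.2]
    · refine fun y hy hys => hGface _ hx y hy fun v hv => hys v ?_
      simp [hv]
  refine ⟨i, ⟨geometricComplex Subtype.val_injective hGinj L fun s hs => hs.2, ?_, ?_, ?_⟩,
    funext hpi, L, fun s hs => hs.1, ?_⟩
  · exact (Set.toFinite L.faces).image _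
  · ext x
    rw [Geometry.SimplicialComplex.mem_space_iff]
    constructor
    · rintro ⟨_, ⟨s, hs, rfl⟩, hx⟩
      obtain ⟨w, hw, hws, rfl⟩ := (mem_convexHull_image_iff Subtype.val_injective s x).1 hx
      have := (p hQ ⟨w, mem_realization_iff.2 ⟨s, hs.1, hw, hws⟩⟩).2
      rwa [coe_p] at this
    · intro hx
      obtain ⟨s, hs, h1, h2⟩ := hL (i ⟨x, hx⟩) (hiG _)
      exact ⟨_, ⟨s, hs, rfl⟩,
        (mem_convexHull_image_iff Subtype.val_injective s x).2 ⟨_, h1, h2, hfi _⟩⟩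
  · rintro _ ⟨s, hs, rfl⟩
    obtain ⟨g, hg⟩ := hs.2.exists_affineMap hGinj
    refine ⟨g, fun x hx => ?_⟩
    obtain ⟨w, hw, hws, hwx⟩ := (mem_convexHull_image_iff Subtype.val_injective s _).1 hx
    rw [← hwx, hg w hw hws]
    -- On each simplex, `i` and the barycentric coordinates both pick the point of `G` over `x`.
    exact hGinj (hiG x) (hs.2 w hw hws) ((hfi x).trans hwx.symm)
  · ext w
    constructor
    · rintro ⟨_, ⟨y, rfl⟩, rfl⟩
      exact mem_realization_iff.2 (hL (i y) (hiG y))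
    · intro hw
      obtain ⟨s, hs, hws, hsupp⟩ := mem_realization_iff.1 hw
      have hwh : w ∈ realization (hat Q) := mem_realization_iff.2 ⟨s, hs.1, hws, hsupp⟩
      exact ⟨_, ⟨p hQ ⟨w, hwh⟩, rfl⟩, congrArg Subtype.val (hip ⟨w, hwh⟩ (hs.2 w hws hsupp))⟩

end Polytope

end PolytopeHat

theorem mainTheorem8 {E : Type*} [NormedAddCommGroup E] [NormedSpace ℝ E] [FiniteDimensional ℝ E]
    (n : ℕ) (Q : Set E) (hQ : PolytopeHat.IsPolytope Q) (hn : PolytopeHat.dim Q = n) :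
    ∃ i : PolytopeHat.boundary Q → PolytopeHat.realization (PolytopeHat.hat Q),
      PolytopeHat.IsPiecewiseLinear i ∧ Topology.IsEmbedding i ∧
      PolytopeHat.p hQ ∘ i = id ∧
      (∃ L : PreAbstractSimplicialComplex (PolytopeHat.Vertex Q), L ≤ PolytopeHat.hat Q ∧
        Subtype.val '' Set.range i = PolytopeHat.realization L) ∧
      Nonempty (Set.range i ≃ₜ Metric.sphere (0 : EuclideanSpace ℝ (Fin n)) 1) ∧
      PolytopeHat.IsStrongDeformationRetract (Set.range i) := by
  have := hQ.finite_extremePoints.fintype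
  obtain ⟨i, hi, hpi, hL⟩ := PolytopeHat.exists_isPiecewiseLinear_section hQ
  have hemb : Topology.IsEmbedding i :=
    Topology.IsEmbedding.of_leftInverse (congrFun hpi) (PolytopeHat.continuous_p hQ) hi.continuous
  obtain ⟨h⟩ := PolytopeHat.nonempty_boundary_homeomorph_sphere hQ hn
  exact ⟨i, hi, hemb, hpi, hL, ⟨hemb.toHomeomorph.symm.trans h⟩,
    PolytopeHat.isStrongDeformationRetract_range hQ hi.continuous hpi⟩
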